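/- Let $p \ge 1$ be an integer, let $\mathbb{D}$ be the open unit disc, and let $H^2_{\mathbb{C}^p}(\mathbb{D})$ be the Hardy space of holomorphic functions $f : \mathbb{D} \to \mathbb{C}^p$ with $\|f\|^2 = \sup_{0 \le r < 1} \frac{1}{2\pi}\int_0^{2\pi} \|f(re^{it})\|^2\,dt < \infty$, a Hilbert space on which $T_z$ denotes the shift, $(T_z f)(w) = w f(w)$. Let $\Theta \in H^\infty_{\mathcal{B}(\mathbb{C}^p)}(\mathbb{D})$ be an inner multiplier, that is, a bounded holomorphic function $\Theta : \mathbb{D} \to \mathcal{B}(\mathbb{C}^p)$ whose radial boundary values $\Theta(e^{it}) = \lim_{r \to 1^-} \Theta(re^{it})$ are isometries for almost every $t$. Put $\mathcal{Q}_\Theta = H^2_{\mathbb{C}^p}(\mathbb{D}) \ominus \Theta H^2_{\mathbb{C}^p}(\mathbb{D})$ and $S_\Theta = P_{\mathcal{Q}_\Theta} T_z|_{\mathcal{Q}_\Theta} \in \mathcal{B}(\mathcal{Q}_\Theta)$, where $P_{\mathcal{Q}_\Theta}$ is the orthogonal projection onto $\mathcal{Q}_\Theta$. Let $T \in \mathcal{B}(\mathcal{Q}_\Theta)$.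 Then the following are equivalent: (i) the sequence $\{S_\Theta^{*m} T S_\Theta^m\}_{m \ge 1}$ converges in norm to some operator in $\mathcal{B}(\mathcal{Q}_\Theta)$; (ii) $S_\Theta^{*m} T S_\Theta^m \to 0$ in norm as $m \to \infty$; (iii) $T$ is a compact operator. -/

import Mathlib

open Filter Topology Metric

noncomputable section

namespace VectorHardy

/-- The `n`-th Taylor coefficient at the origin of a function of one complex variable. -/
def taylorCoeff {E : Type*} [NormedAddCommGroup E] [NormedSpace ℂ E] (f : ℂ → E) (n : ℕ) : E :=
  ((n.factorial : ℂ)⁻¹) • iteratedDeriv n f 0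

section Parseval

variable {E : Type*} [NormedAddCommGroup E] [InnerProductSpace ℂ E]

theorem hasSum_taylorCoeff [CompleteSpace E] {f : ℂ → E} (hf : DifferentiableOn ℂ f (ball 0 1))
    {z : ℂ} (hz : z ∈ ball (0 : ℂ) 1) : HasSum (fun n : ℕ => z ^ n • taylorCoeff f n) (f z) := by
  have h := Complex.hasSum_taylorSeries_on_ball hf hz
  refine h.congr_fun ?_
  intro n
  simp only [taylorCoeff, sub_zero]
  rw [smul_comm]

theorem circleMap_mem_unit {r : ℝ} (hr0 : 0 ≤ r) (hr1 : r < 1) (t : ℝ) :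
    circleMap 0 r t ∈ ball (0 : ℂ) 1 := by
  simp [circleMap, abs_of_nonneg hr0, hr1]

theorem summable_radius {f : ℂ → E} {a : ℕ → E}
    (ha : ∀ z ∈ ball (0 : ℂ) 1, HasSum (fun n : ℕ => z ^ n • a n) (f z))
    {r : ℝ} (hr0 : 0 ≤ r) (hr1 : r < 1) : Summable fun n : ℕ => r ^ n * ‖a n‖ := by
  obtain ⟨s, hrs, hs1⟩ := exists_between hr1
  have hs0 : 0 < s := hr0.trans_lt hrs
  have h1 := (ha (s : ℂ) (by simp [abs_of_pos hs0, hs1])).summable.tendsto_atTop_zero.norm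
  obtain ⟨C, hC⟩ := h1.bddAbove_range
  have hg : Summable fun n : ℕ => C * (r / s) ^ n :=
    (summable_geometric_of_lt_one (by positivity) ((div_lt_one hs0).2 hrs)).mul_left C
  refine hg.of_nonneg_of_le (fun n => by positivity) (fun n => ?_)
  have h2 : s ^ n * ‖a n‖ ≤ C := by
    have := hC ⟨n, rfl⟩
    simpa [norm_smul, abs_of_pos hs0] using this
  have h3 : r ^ n * ‖a n‖ = (s ^ n * ‖a n‖) * (r / s) ^ n := by
    rw [div_pow]
    field_simp
  rw [h3]
  gcongr

theorem integral_circleMap_inner (r : ℝ) (x y : E) (n m : ℕ) :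
    ∫ t in (0 : ℝ)..2 * Real.pi, inner ℂ (circleMap 0 r t ^ n • x) (circleMap 0 r t ^ m • y)
      = if m = n then (2 * Real.pi : ℂ) * ((r : ℂ) ^ (2 * n) * inner ℂ x y) else 0 := by
  have h : ∀ t : ℝ, inner ℂ (circleMap 0 r t ^ n • x) (circleMap 0 r t ^ m • y)
      = Complex.exp ((((m : ℂ) - n) * Complex.I) * t) * ((r : ℂ) ^ (n + m) * inner ℂ x y) := by
    intro t
    rw [inner_smul_left, inner_smul_right]
    have e : Complex.exp ((((m : ℂ) - n) * Complex.I) * t)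
        = (starRingEnd ℂ (Complex.exp (t * Complex.I))) ^ n * Complex.exp (t * Complex.I) ^ m := by
      rw [← Complex.exp_conj, ← Complex.exp_nat_mul, ← Complex.exp_nat_mul, ← Complex.exp_add]
      congr 1
      simp
      ring
    rw [e]
    simp [circleMap]
    ring
  simp_rw [h]
  rw [intervalIntegral.integral_mul_const]
  split_ifs with hmn
  · subst hmn
    rw [← two_mul]
    simp
  · rw [integral_exp_mul_complex]
    · have e2 : (((m : ℂ) - n) * Complex.I) * ((2 * Real.pi : ℝ) : ℂ)
          = (((m : ℤ) - (n : ℤ) : ℤ) : ℂ) * (2 * Real.pi * Complex.I) := by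
        push_cast
        ring
      rw [e2, Complex.exp_int_mul_two_pi_mul_I]
      simp
    · have : (m : ℂ) - n ≠ 0 := by
        rw [sub_ne_zero]
        exact_mod_cast hmn
      simp [this]

/-- Parseval's identity on the circle of radius `r`. -/
theorem hasSum_circleAverage {f : ℂ → E} {a : ℕ → E} (hf : ContinuousOn f (ball 0 1))
    (ha : ∀ z ∈ ball (0 : ℂ) 1, HasSum (fun n : ℕ => z ^ n • a n) (f z))
    {r : ℝ} (hr0 : 0 ≤ r) (hr1 : r < 1) :
    HasSum (fun n : ℕ => r ^ (2 * n) * ‖a n‖ ^ 2)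
      (Real.circleAverage (fun z => ‖f z‖ ^ 2) 0 r) := by
  have hb := summable_radius ha hr0 hr1
  have hfc : Continuous fun t : ℝ => f (circleMap 0 r t) :=
    hf.comp_continuous (continuous_circleMap 0 r) (circleMap_mem_unit hr0 hr1)
  have hn : ∀ (n : ℕ) (t : ℝ), ‖circleMap 0 r t ^ n • a n‖ = r ^ n * ‖a n‖ := by
    intro n t
    simp [norm_smul, abs_of_nonneg hr0]
  have hcont : ∀ n : ℕ, Continuous fun t : ℝ => circleMap 0 r t ^ n • a n := fun n =>
    ((continuous_circleMap 0 r).pow n).smul continuous_const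
  have hfn : ∀ t : ℝ, ‖f (circleMap 0 r t)‖ ≤ ∑' n : ℕ, r ^ n * ‖a n‖ := by
    intro t
    have h1 := ha _ (circleMap_mem_unit hr0 hr1 t)
    rw [← h1.tsum_eq]
    have h2 : Summable fun n : ℕ => ‖circleMap 0 r t ^ n • a n‖ := by simpa only [hn] using hb
    exact (norm_tsum_le_tsum_norm h2).trans_eq (by simp only [hn])
  -- the integral of one term against `f`
  have hA : ∀ n : ℕ, ∫ t in (0 : ℝ)..2 * Real.pi,
      inner ℂ (circleMap 0 r t ^ n • a n) (f (circleMap 0 r t))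
        = (2 * Real.pi : ℂ) * ((r : ℂ) ^ (2 * n) * inner ℂ (a n) (a n)) := by
    intro n
    have hs := intervalIntegral.hasSum_integral_of_dominated_convergence
      (μ := MeasureTheory.volume) (a := 0) (b := 2 * Real.pi)
      (F := fun (m : ℕ) (t : ℝ) => inner ℂ (circleMap 0 r t ^ n • a n) (circleMap 0 r t ^ m • a m))
      (f := fun t : ℝ => inner ℂ (circleMap 0 r t ^ n • a n) (f (circleMap 0 r t)))
      (fun m _ => (r ^ n * ‖a n‖) * (r ^ m * ‖a m‖))
      (fun m => ((hcont n).inner (hcont m)).aestronglyMeasurable)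
      (fun m => Eventually.of_forall fun t _ => by
        rw [← hn n t, ← hn m t]
        exact norm_inner_le_norm _ _)
      (Eventually.of_forall fun t _ => hb.mul_left _)
      intervalIntegrable_const
      (Eventually.of_forall fun t _ =>
        (ha _ (circleMap_mem_unit hr0 hr1 t)).mapL (innerSL ℂ (circleMap 0 r t ^ n • a n)))
    simp only [integral_circleMap_inner] at hs
    have hs2 := hasSum_ite_eq n ((2 * Real.pi : ℂ) * ((r : ℂ) ^ (2 * n) * inner ℂ (a n) (a n)))
    refine hs.unique (hs2.congr_fun ?_)
    intro m
    by_cases hmn : m = n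
    · subst hmn; simp
    · simp [hmn]
  have hB := intervalIntegral.hasSum_integral_of_dominated_convergence
      (μ := MeasureTheory.volume) (a := 0) (b := 2 * Real.pi)
      (F := fun (n : ℕ) (t : ℝ) => inner ℂ (circleMap 0 r t ^ n • a n) (f (circleMap 0 r t)))
      (f := fun t : ℝ => inner ℂ (f (circleMap 0 r t)) (f (circleMap 0 r t)))
      (fun m _ => (r ^ m * ‖a m‖) * ∑' n : ℕ, r ^ n * ‖a n‖)
      (fun m => ((hcont m).inner hfc).aestronglyMeasurable)
      (fun m => Eventually.of_forall fun t _ => by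
        rw [← hn m t]
        exact (norm_inner_le_norm _ _).trans (by gcongr; exact hfn t))
      (Eventually.of_forall fun t _ => hb.mul_right _)
      intervalIntegrable_const
      (Eventually.of_forall fun t _ => by
        have h1 := (ha _ (circleMap_mem_unit hr0 hr1 t)).mapL
          (innerSL ℂ (f (circleMap 0 r t)))
        have h2 := h1.map (starRingEnd ℂ) Complex.continuous_conj
        simpa [Function.comp_def, mul_comm, -inner_self_eq_norm_sq_to_K] using! h2)
  simp only [hA, inner_self_eq_norm_sq_to_K] at hB
  have hC : (∫ t in (0 : ℝ)..2 * Real.pi, ((‖f (circleMap 0 r t)‖ : ℂ)) ^ 2)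
      = ((∫ t in (0 : ℝ)..2 * Real.pi, ‖f (circleMap 0 r t)‖ ^ 2 : ℝ) : ℂ) := by
    rw [← intervalIntegral.integral_ofReal]
    congr 1
    funext t
    push_cast
    rfl
  have hD : HasSum (fun n : ℕ => (2 * Real.pi) * (r ^ (2 * n) * ‖a n‖ ^ 2))
      (∫ t in (0 : ℝ)..2 * Real.pi, ‖f (circleMap 0 r t)‖ ^ 2) := by
    rw [← Complex.hasSum_ofReal, ← hC]
    refine hB.congr_fun ?_
    intro n
    push_cast
    rfl
  have hE := hD.mul_left (2 * Real.pi)⁻¹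
  rw [Real.circleAverage_def, smul_eq_mul]
  refine hE.congr_fun ?_
  intro n
  have := Real.pi_ne_zero
  field_simp

theorem expansion_unique {f : ℂ → E} {a b : ℕ → E}
    (ha : ∀ z ∈ ball (0 : ℂ) 1, HasSum (fun n : ℕ => z ^ n • a n) (f z))
    (hb : ∀ z ∈ ball (0 : ℂ) 1, HasSum (fun n : ℕ => z ^ n • b n) (f z)) : a = b := by
  have h : ∀ z ∈ ball (0 : ℂ) 1, HasSum (fun n : ℕ => z ^ n • (a n - b n)) ((0 : ℂ → E) z) := by
    intro z hz
    simpa [smul_sub] using (ha z hz).sub (hb z hz)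
  have h0 : ContinuousOn (0 : ℂ → E) (ball 0 1) := continuousOn_const
  have h1 := hasSum_circleAverage h0 h (r := 1 / 2) (by norm_num) (by norm_num)
  have h2 : Real.circleAverage (fun z => ‖(0 : ℂ → E) z‖ ^ 2) 0 (1 / 2) = 0 := by
    simp [Real.circleAverage_def]
  rw [h2, hasSum_zero_iff_of_nonneg (fun n => by positivity)] at h1
  funext n
  have h3 := congrFun h1 n
  simpa [sub_eq_zero] using h3

theorem taylorCoeff_eq [CompleteSpace E] {f : ℂ → E} (hf : DifferentiableOn ℂ f (ball 0 1))
    {a : ℕ → E} (ha : ∀ z ∈ ball (0 : ℂ) 1, HasSum (fun n : ℕ => z ^ n • a n) (f z)) :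
    taylorCoeff f = a :=
  expansion_unique (fun _ hz => hasSum_taylorCoeff hf hz) ha

/-- The mean square of `f` over the circle of radius `r` about the origin. -/
def meanSq (f : ℂ → E) (r : Set.Ico (0 : ℝ) 1) : ℝ :=
  Real.circleAverage (fun z => ‖f z‖ ^ 2) 0 r

theorem sum_le_of_meanSq_le {f : ℂ → E} {a : ℕ → E} (hf : ContinuousOn f (ball 0 1))
    (ha : ∀ z ∈ ball (0 : ℂ) 1, HasSum (fun n : ℕ => z ^ n • a n) (f z)) {C : ℝ}
    (hC : ∀ r, meanSq f r ≤ C) (s : Finset ℕ) : ∑ n ∈ s, ‖a n‖ ^ 2 ≤ C := by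
  have h1 : ∀ r ∈ Set.Ico (0 : ℝ) 1, ∑ n ∈ s, r ^ (2 * n) * ‖a n‖ ^ 2 ≤ C := by
    intro r hr
    have h := hasSum_circleAverage hf ha hr.1 hr.2
    exact (sum_le_hasSum s (fun n _ => mul_nonneg (pow_nonneg hr.1 _) (by positivity)) h).trans
      (hC ⟨r, hr⟩)
  have h2 : Tendsto (fun r : ℝ => ∑ n ∈ s, r ^ (2 * n) * ‖a n‖ ^ 2) (𝓝[<] 1)
      (𝓝 (∑ n ∈ s, (1 : ℝ) ^ (2 * n) * ‖a n‖ ^ 2)) := by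
    have : Continuous fun r : ℝ => ∑ n ∈ s, r ^ (2 * n) * ‖a n‖ ^ 2 := by fun_prop
    exact this.continuousAt.tendsto.mono_left nhdsWithin_le_nhds
  simp only [one_pow, one_mul] at h2
  refine le_of_tendsto h2 ?_
  filter_upwards [Ico_mem_nhdsLT (zero_lt_one' ℝ)] with r hr using h1 r hr

theorem meanSq_le {f : ℂ → E} {a : ℕ → E} (hf : ContinuousOn f (ball 0 1))
    (ha : ∀ z ∈ ball (0 : ℂ) 1, HasSum (fun n : ℕ => z ^ n • a n) (f z))
    (hs : Summable fun n => ‖a n‖ ^ 2) (r : Set.Ico (0 : ℝ) 1) :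
    meanSq f r ≤ ∑' n, ‖a n‖ ^ 2 := by
  refine hasSum_le (fun n => ?_) (hasSum_circleAverage hf ha r.2.1 r.2.2) hs.hasSum
  exact mul_le_of_le_one_left (by positivity) (pow_le_one₀ r.2.1 r.2.2.le)

theorem bddAbove_meanSq_iff {f : ℂ → E} {a : ℕ → E} (hf : ContinuousOn f (ball 0 1))
    (ha : ∀ z ∈ ball (0 : ℂ) 1, HasSum (fun n : ℕ => z ^ n • a n) (f z)) :
    BddAbove (Set.range (meanSq f)) ↔ Summable fun n => ‖a n‖ ^ 2 := by
  constructor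
  · rintro ⟨C, hC⟩
    exact summable_of_sum_le (fun n => by positivity)
      (sum_le_of_meanSq_le hf ha fun r => hC ⟨r, rfl⟩)
  · intro hs
    refine ⟨∑' n, ‖a n‖ ^ 2, ?_⟩
    rintro _ ⟨r, rfl⟩
    exact meanSq_le hf ha hs r

theorem iSup_meanSq {f : ℂ → E} {a : ℕ → E} (hf : ContinuousOn f (ball 0 1))
    (ha : ∀ z ∈ ball (0 : ℂ) 1, HasSum (fun n : ℕ => z ^ n • a n) (f z))
    (hs : Summable fun n => ‖a n‖ ^ 2) : ⨆ r, meanSq f r = ∑' n, ‖a n‖ ^ 2 := by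
  have : Nonempty (Set.Ico (0 : ℝ) 1) := ⟨⟨0, by simp⟩⟩
  refine le_antisymm (ciSup_le (meanSq_le hf ha hs)) ?_
  exact hs.tsum_le_of_sum_le
    (sum_le_of_meanSq_le hf ha fun r => le_ciSup ((bddAbove_meanSq_iff hf ha).2 hs) r)

theorem summable_norm_sq_add {E : Type*} [NormedAddCommGroup E] {a b : ℕ → E} (ha : Summable fun n => ‖a n‖ ^ 2)
    (hb : Summable fun n => ‖b n‖ ^ 2) : Summable fun n => ‖a n + b n‖ ^ 2 := by
  refine ((ha.add hb).mul_left 2).of_nonneg_of_le (fun n => by positivity) (fun n => ?_)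
  have h := norm_add_le (a n) (b n)
  have h0 := norm_nonneg (a n + b n)
  nlinarith [sq_nonneg (‖a n‖ - ‖b n‖)]

end Parseval

section Space

variable (E : Type*) [NormedAddCommGroup E] [InnerProductSpace ℂ E] [CompleteSpace E]

/-- The `E`-valued holomorphic functions on the open unit disc with bounded mean squares, as a
space of functions on `ℂ`: functions on the disc are extended by zero. -/
def hardySubmodule : Submodule ℂ (ℂ → E) where
  carrier := {f | DifferentiableOn ℂ f (ball 0 1) ∧ (∀ z ∉ ball (0 : ℂ) 1, f z = 0) ∧
    BddAbove (Set.range (meanSq f))}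
  zero_mem' := by
    refine ⟨differentiableOn_const 0, fun _ _ => rfl, 0, ?_⟩
    rintro _ ⟨r, rfl⟩
    simp [meanSq, Real.circleAverage_def]
  add_mem' := by
    rintro f g ⟨hf, hf0, hfb⟩ ⟨hg, hg0, hgb⟩
    refine ⟨hf.add hg, fun z hz => by simp [hf0 z hz, hg0 z hz], ?_⟩
    rw [bddAbove_meanSq_iff hf.continuousOn fun z => hasSum_taylorCoeff hf] at hfb
    rw [bddAbove_meanSq_iff hg.continuousOn fun z => hasSum_taylorCoeff hg] at hgb
    rw [bddAbove_meanSq_iff (a := taylorCoeff f + taylorCoeff g) (hf.add hg).continuousOn]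
    · exact summable_norm_sq_add hfb hgb
    · intro z hz
      simpa using (hasSum_taylorCoeff hf hz).add (hasSum_taylorCoeff hg hz)
  smul_mem' := by
    rintro c f ⟨hf, hf0, hfb⟩
    refine ⟨hf.const_smul c, fun z hz => by simp [hf0 z hz], ?_⟩
    obtain ⟨C, hC⟩ := hfb
    refine ⟨‖c‖ ^ 2 * C, ?_⟩
    rintro _ ⟨r, rfl⟩
    have h : meanSq (c • f) r = ‖c‖ ^ 2 * meanSq f r := by
      simp [meanSq, Real.circleAverage_def, norm_smul, mul_pow]
      ring
    rw [h]
    have := hC ⟨r, rfl⟩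
    gcongr

/-- The Hardy space `H²_E(𝔻)`. -/
def HardySpace : Type _ := hardySubmodule E

namespace HardySpace

instance : AddCommGroup (HardySpace E) := inferInstanceAs (AddCommGroup (hardySubmodule E))

instance : Module ℂ (HardySpace E) := inferInstanceAs (Module ℂ (hardySubmodule E))

variable {E}

instance : CoeFun (HardySpace E) fun _ => ℂ → E := ⟨fun f => f.1⟩

/-- `‖f‖² = sup_{0 ≤ r < 1} (2π)⁻¹ ∫₀^{2π} ‖f(r e^{it})‖² dt`. -/
instance : Norm (HardySpace E) := ⟨fun f => √(⨆ r, meanSq f r)⟩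

theorem norm_def (f : HardySpace E) : ‖f‖ = √(⨆ r, meanSq f r) := rfl

@[ext] theorem ext {f g : HardySpace E} (h : ∀ z ∈ ball (0 : ℂ) 1, f z = g z) : f = g := by
  apply Subtype.ext
  funext z
  by_cases hz : z ∈ ball (0 : ℂ) 1
  · exact h z hz
  · exact (f.2.2.1 z hz).trans (g.2.2.1 z hz).symm

@[simp] theorem add_apply (f g : HardySpace E) (z : ℂ) : (f + g) z = f z + g z := rfl

@[simp] theorem smul_apply (c : ℂ) (f : HardySpace E) (z : ℂ) : (c • f) z = c • f z := rfl

theorem differentiableOn (f : HardySpace E) : DifferentiableOn ℂ f (ball 0 1) := f.2.1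

theorem hasSum (f : HardySpace E) {z : ℂ} (hz : z ∈ ball (0 : ℂ) 1) :
    HasSum (fun n : ℕ => z ^ n • taylorCoeff f n) (f z) :=
  hasSum_taylorCoeff f.differentiableOn hz

theorem summable_coeff (f : HardySpace E) : Summable fun n => ‖taylorCoeff f n‖ ^ 2 :=
  (bddAbove_meanSq_iff f.differentiableOn.continuousOn fun _ => f.hasSum).1 f.2.2.2

/-- The sequence of Taylor coefficients, as an element of `ℓ²(ℕ, E)`. -/
def coeffLp (f : HardySpace E) : lp (fun _ : ℕ => E) 2 :=
  ⟨taylorCoeff f, memℓp_gen (by simpa using f.summable_coeff)⟩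

@[simp] theorem coeffLp_apply (f : HardySpace E) (n : ℕ) : coeffLp f n = taylorCoeff f n := rfl

theorem norm_coeffLp (f : HardySpace E) : ‖coeffLp f‖ = ‖f‖ := by
  rw [norm_def, iSup_meanSq f.differentiableOn.continuousOn (fun _ => f.hasSum) f.summable_coeff,
    ← Real.sqrt_sq (norm_nonneg (coeffLp f))]
  congr 1
  simpa using lp.norm_rpow_eq_tsum (p := 2) (by simp) (coeffLp f)

theorem coeffLp_add (f g : HardySpace E) : coeffLp (f + g) = coeffLp f + coeffLp g := by
  apply lp.ext
  refine taylorCoeff_eq (f + g).differentiableOn fun z hz => ?_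
  simpa using (f.hasSum hz).add (g.hasSum hz)

theorem coeffLp_smul (c : ℂ) (f : HardySpace E) : coeffLp (c • f) = c • coeffLp f := by
  apply lp.ext
  refine taylorCoeff_eq (c • f).differentiableOn fun z hz => ?_
  simpa [smul_comm c] using (f.hasSum hz).const_smul c

theorem coeffLp_injective : Function.Injective (coeffLp : HardySpace E → _) := by
  intro f g h
  apply ext
  intro z hz
  have h1 : taylorCoeff f = taylorCoeff g := congrArg Subtype.val h
  have h2 := f.hasSum hz
  rw [h1] at h2
  exact h2.unique (g.hasSum hz)

theorem core : NormedSpace.Core ℂ (HardySpace E) where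
  norm_nonneg f := Real.sqrt_nonneg _
  norm_smul c f := by rw [← norm_coeffLp, ← norm_coeffLp, coeffLp_smul, norm_smul]
  norm_triangle f g := by
    rw [← norm_coeffLp, ← norm_coeffLp, ← norm_coeffLp, coeffLp_add]
    exact norm_add_le _ _
  norm_eq_zero_iff f := by
    have h0 : coeffLp (0 : HardySpace E) = 0 := by
      simpa using coeffLp_smul (0 : ℂ) (0 : HardySpace E)
    rw [← norm_coeffLp, norm_eq_zero, ← h0, coeffLp_injective.eq_iff]

instance : NormedAddCommGroup (HardySpace E) := NormedAddCommGroup.ofCore core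

instance : NormedSpace ℂ (HardySpace E) := NormedSpace.ofCore core

/-- The inner product `⟪f, g⟫ = ∑ ⟪aₙ, bₙ⟫` of `f = ∑ aₙ zⁿ` and `g = ∑ bₙ zⁿ`: the one that induces
the norm. -/
instance : InnerProductSpace ℂ (HardySpace E) where
  inner f g := ∑' n, inner ℂ (taylorCoeff f n) (taylorCoeff g n)
  norm_sq_eq_re_inner f := by
    rw [← norm_coeffLp]
    exact norm_sq_eq_re_inner (𝕜 := ℂ) (coeffLp f)
  conj_inner_symm f g := inner_conj_symm (coeffLp f) (coeffLp g)
  add_left f g h := by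
    have := inner_add_left (𝕜 := ℂ) (coeffLp f) (coeffLp g) (coeffLp h)
    rw [← coeffLp_add] at this
    exact this
  smul_left f g c := by
    have := inner_smul_left (𝕜 := ℂ) (coeffLp f) (coeffLp g) c
    rw [← coeffLp_smul] at this
    exact this

theorem inner_def (f g : HardySpace E) :
    inner ℂ f g = ∑' n, inner ℂ (taylorCoeff f n) (taylorCoeff g n) := rfl

theorem coeffLp_surjective : Function.Surjective (coeffLp : HardySpace E → _) := by
  intro a
  have hs : Summable fun n => ‖a n‖ ^ 2 := by simpa using (lp.memℓp a).summable (by simp)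
  obtain ⟨C, hC⟩ : ∃ C, ∀ n, ‖a n‖ ≤ C := ⟨‖a‖, lp.norm_apply_le_norm (by simp) a⟩
  let F : ℂ → E := fun z => ∑' n : ℕ, z ^ n • a n
  have hbd : ∀ (z : ℂ) (n : ℕ), ‖z ^ n • a n‖ ≤ C * ‖z‖ ^ n := by
    intro z n
    rw [norm_smul, norm_pow, mul_comm]
    gcongr
    exact hC n
  have hF : ∀ z ∈ ball (0 : ℂ) 1, HasSum (fun n : ℕ => z ^ n • a n) (F z) := by
    intro z hz
    rw [mem_ball_zero_iff] at hz
    exact (Summable.of_norm_bounded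
      ((summable_geometric_of_lt_one (norm_nonneg z) hz).mul_left C) (hbd z)).hasSum
  have hd : DifferentiableOn ℂ F (ball 0 1) := by
    intro z hz
    rw [mem_ball_zero_iff] at hz
    obtain ⟨s, hzs, hs1⟩ := exists_between hz
    have hs0 : 0 ≤ s := (norm_nonneg z).trans hzs.le
    have h := Complex.differentiableOn_tsum_of_summable_norm (U := ball (0 : ℂ) s)
      (F := fun (n : ℕ) (z : ℂ) => z ^ n • a n)
      ((summable_geometric_of_lt_one hs0 hs1).mul_left C)
      (fun n => by fun_prop) isOpen_ball (fun n w hw => by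
        rw [mem_ball_zero_iff] at hw
        refine (hbd w n).trans ?_
        have : 0 ≤ C := (norm_nonneg _).trans (hC 0)
        gcongr)
    exact (h.differentiableAt (isOpen_ball.mem_nhds (by simpa using hzs))).differentiableWithinAt
  classical
  let G : ℂ → E := (ball (0 : ℂ) 1).indicator F
  have hGF : Set.EqOn G F (ball 0 1) := Set.eqOn_indicator
  have hGd : DifferentiableOn ℂ G (ball 0 1) := hd.congr hGF
  have hGs : ∀ z ∈ ball (0 : ℂ) 1, HasSum (fun n : ℕ => z ^ n • a n) (G z) := by
    intro z hz
    rw [hGF hz]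
    exact hF z hz
  refine ⟨⟨G, hGd, fun z hz => Set.indicator_of_notMem hz F,
    (bddAbove_meanSq_iff hGd.continuousOn hGs).2 hs⟩, ?_⟩
  apply lp.ext
  exact taylorCoeff_eq hGd hGs

/-- A function in `H²_E(𝔻)` is determined by its Taylor coefficients, which may be any sequence in
`ℓ²(ℕ, E)`; the correspondence is unitary. -/
def coeffEquiv : HardySpace E ≃ₗᵢ[ℂ] lp (fun _ : ℕ => E) 2 where
  toLinearEquiv := LinearEquiv.ofBijective
    { toFun := coeffLp, map_add' := coeffLp_add, map_smul' := coeffLp_smul }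
    ⟨coeffLp_injective, coeffLp_surjective⟩
  norm_map' := norm_coeffLp

instance : CompleteSpace (HardySpace E) :=
  (completeSpace_congr (e := (coeffEquiv (E := E)).toEquiv)
    (coeffEquiv (E := E)).isometry.isUniformEmbedding).2 inferInstance

end HardySpace

/-- A bounded holomorphic function on the open unit disc with values in `B(E)`, that is, an element
of `H^∞_{B(E)}(𝔻)`; the values of `toFun` off the disc play no role. -/
structure HInfty where
  toFun : ℂ → E →L[ℂ] E
  differentiableOn' : DifferentiableOn ℂ toFun (ball 0 1)
  bounded' : ∃ C : ℝ, ∀ z ∈ ball (0 : ℂ) 1, ‖toFun z‖ ≤ C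

variable {E}

namespace HInfty

instance : CoeFun (HInfty E) fun _ => ℂ → E →L[ℂ] E := ⟨toFun⟩

/-- `Θ` is inner: for almost every `t` the radial limit of `Θ` at `e^{it}` exists in the strong
operator topology and is an isometry. -/
def IsInner (Θ : HInfty E) : Prop :=
  ∀ᵐ t : ℝ, ∃ V : E →L[ℂ] E, (∀ x, ‖V x‖ = ‖x‖) ∧
    ∀ x, Tendsto (fun r : ℝ => Θ (circleMap 0 r t) x) (𝓝[<] 1) (𝓝 (V x))

theorem meanSq_mul_le (Θ : HInfty E) {C : ℝ} (hC : ∀ z ∈ ball (0 : ℂ) 1, ‖Θ z‖ ≤ C)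
    (f : HardySpace E) (r : Set.Ico (0 : ℝ) 1) :
    meanSq ((ball (0 : ℂ) 1).indicator fun z => Θ z (f z)) r ≤ C ^ 2 * meanSq f r := by
  have hsub : sphere (0 : ℂ) |(r : ℝ)| ⊆ ball 0 1 := by
    rw [abs_of_nonneg r.2.1]
    exact sphere_subset_ball r.2.2
  have hf : ContinuousOn f (ball 0 1) := f.differentiableOn.continuousOn
  have hg : ContinuousOn ((ball (0 : ℂ) 1).indicator fun z => Θ z (f z)) (ball 0 1) :=
    (Θ.differentiableOn'.continuousOn.clm_apply hf).congr Set.eqOn_indicator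
  have h1 : C ^ 2 * meanSq f r = Real.circleAverage (fun z => C ^ 2 * ‖f z‖ ^ 2) 0 r := by
    simp only [meanSq, Real.circleAverage_def, smul_eq_mul, intervalIntegral.integral_const_mul]
    ring
  rw [h1]
  refine Real.circleAverage_mono ?_ ?_ ?_
  · exact ((hg.mono hsub).norm.pow 2).circleIntegrable'
  · exact (((hf.mono hsub).norm.pow 2).const_mul (C ^ 2)).circleIntegrable'
  · intro z hz
    rw [Set.indicator_of_mem (hsub hz), ← mul_pow]
    gcongr
    exact (Θ z).le_of_opNorm_le (hC z (hsub hz)) (f z)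

/-- The product `Θ f` of `Θ` and a function `f` in `H²_E(𝔻)`. -/
def mul (Θ : HInfty E) (f : HardySpace E) : HardySpace E :=
  ⟨(ball (0 : ℂ) 1).indicator fun z => Θ z (f z),
    (Θ.differentiableOn'.clm_apply f.differentiableOn).congr Set.eqOn_indicator,
    fun _ hz => Set.indicator_of_notMem hz _, by
      obtain ⟨C, hC⟩ := Θ.bounded'
      obtain ⟨B, hB⟩ := f.2.2.2
      refine ⟨C ^ 2 * B, ?_⟩
      rintro _ ⟨r, rfl⟩
      have := hB ⟨r, rfl⟩
      exact (Θ.meanSq_mul_le hC f r).trans (by gcongr)⟩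

theorem mul_apply (Θ : HInfty E) (f : HardySpace E) {z : ℂ} (hz : z ∈ ball (0 : ℂ) 1) :
    Θ.mul f z = Θ z (f z) :=
  Set.indicator_of_mem hz fun z => Θ z (f z)

/-- The multiplication operator `f ↦ Θ f` on `H²_E(𝔻)`. -/
def mulOp (Θ : HInfty E) : HardySpace E →L[ℂ] HardySpace E :=
  LinearMap.mkContinuousOfExistsBound
    { toFun := Θ.mul
      map_add' := fun f g => by
        apply HardySpace.ext
        intro z hz
        simp [mul_apply, hz]
      map_smul' := fun c f => by
        apply HardySpace.ext
        intro z hz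
        simp [mul_apply, hz] }
    (by
      obtain ⟨C, hC⟩ := Θ.bounded'
      have hC0 : 0 ≤ C := (norm_nonneg _).trans (hC 0 (by simp))
      refine ⟨C, fun f => ?_⟩
      rw [HardySpace.norm_def, HardySpace.norm_def, ← Real.sqrt_sq hC0,
        ← Real.sqrt_mul (sq_nonneg C)]
      apply Real.sqrt_le_sqrt
      have : Nonempty (Set.Ico (0 : ℝ) 1) := ⟨⟨0, by simp⟩⟩
      refine ciSup_le fun r => (Θ.meanSq_mul_le hC f r).trans ?_
      have := le_ciSup f.2.2.2 r
      gcongr)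

theorem mulOp_apply (Θ : HInfty E) (f : HardySpace E) {z : ℂ} (hz : z ∈ ball (0 : ℂ) 1) :
    Θ.mulOp f z = Θ z (f z) :=
  Θ.mul_apply f hz

variable (E) in
/-- The function `z ↦ z I`. -/
def coord : HInfty E where
  toFun z := z • ContinuousLinearMap.id ℂ E
  differentiableOn' := by fun_prop
  bounded' := ⟨1, fun z hz => by
    rw [mem_ball_zero_iff] at hz
    rw [norm_smul]
    exact mul_le_one₀ hz.le (norm_nonneg _) ContinuousLinearMap.norm_id_le⟩

end HInfty

variable (E) in
/-- The shift `T_z` on `H²_E(𝔻)`, that is, `(T_z f)(w) = w f(w)`. -/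
def shift : HardySpace E →L[ℂ] HardySpace E := (HInfty.coord E).mulOp

theorem shift_apply (f : HardySpace E) {z : ℂ} (hz : z ∈ ball (0 : ℂ) 1) :
    shift E f z = z • f z :=
  (HInfty.coord E).mulOp_apply f hz

/-- The model space `Q_Θ = H²_E(𝔻) ⊖ Θ H²_E(𝔻)`. -/
def modelSpace (Θ : HInfty E) : Submodule ℂ (HardySpace E) :=
  (LinearMap.range Θ.mulOp.toLinearMap)ᗮ

instance (Θ : HInfty E) : CompleteSpace (modelSpace Θ) :=
  inferInstanceAs (CompleteSpace (LinearMap.range Θ.mulOp.toLinearMap)ᗮ)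

/-- The model operator `S_Θ = P_{Q_Θ} T_z |_{Q_Θ}`, as an operator on `Q_Θ`. -/
def modelOp (Θ : HInfty E) : modelSpace Θ →L[ℂ] modelSpace Θ :=
  (modelSpace Θ).orthogonalProjectionOnto ∘L shift E ∘L (modelSpace Θ).subtypeL

end Space

end VectorHardy

end

/-! ### Contractions with compact defect on an abstract Hilbert space. -/

section CompactDefect

open ContinuousLinearMap

variable {H : Type*} [NormedAddCommGroup H] [InnerProductSpace ℂ H]

/-! Write S for the model operator and P for the projection onto the model space. Only three
properties of the contraction S matter: S^m → 0 strongly, S*^m → 0 strongly, and 1 - S S* is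
compact; `tfae_isCompactOperator_of_compact_defect` deduces the equivalence from them. A norm limit
A satisfies S* A S = A, so ‖A x‖ ≤ ‖A S^m x‖ → 0 and A = 0. If T is compact, S*^m tends to 0
uniformly on the relatively compact image of the unit ball. Conversely, 1 - S^m S*^m is compact, so
T differs from S^m (S*^m T S^m) S*^m by a compact operator, and the latter tends to 0 in norm.

Two of the properties come from the shift. S* is the restriction of the backward shift, which drops
Taylor coefficients, so its powers tend strongly to 0; and 1 - S S* is the compression of the
projection onto the constants, which factors through the finite-dimensional E.

The strong convergence S^m → 0 is where innerness enters. Since S^m P = P T_z^m, it suffices that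
P(z^m x) → 0 for x in E. Multiplication by Θ is isometric on polynomials and Θ*(z^m x) is a
polynomial, whence ‖P(z^m x)‖² ≤ ‖x‖² - ‖Θ*(z^m x)‖². Summed over an orthonormal basis b of E, the
terms ‖Θ*(z^m b_i)‖² add up to the partial sums of ∑_j ‖Θ b_j‖² = dim E, so the defects tend to 0
(`HInfty.IsInner.tendsto_norm_sq_adjoint`). This trace argument replaces the remark that isometric
boundary values are unitary in finite dimension. -/

theorem ContinuousLinearMap.norm_pow_le_one {S : H →L[ℂ] H} (hS : ‖S‖ ≤ 1) (m : ℕ) :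
    ‖S ^ m‖ ≤ 1 := by
  induction m with
  | zero => exact ContinuousLinearMap.norm_id_le
  | succ m ih =>
    rw [pow_succ]
    exact (norm_mul_le _ _).trans (mul_le_one₀ ih (norm_nonneg _) hS)

/-- A bounded sequence of operators converging strongly to zero converges in norm after
composition with a compact operator. -/
theorem IsCompactOperator.tendsto_comp_zero {T : H →L[ℂ] H} (hT : IsCompactOperator T)
    {R : ℕ → H →L[ℂ] H} (hR : ∀ m, ‖R m‖ ≤ 1) (h0 : ∀ x, Tendsto (fun m => R m x) atTop (𝓝 0)) :
    Tendsto (fun m => R m ∘L T) atTop (𝓝 0) := by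
  obtain ⟨K, hK, hTK⟩ := hT.image_closedBall_subset_compact (𝕜₁ := ℂ) (f := (T : H →ₗ[ℂ] H)) 1
  rw [Metric.tendsto_atTop]
  intro ε hε
  -- Two errors of ε/4 give the bound ε/2; the remaining slack turns the non-strict operator norm
  -- bound into a strict one.
  obtain ⟨t, -, htf, ht⟩ := hK.finite_cover_balls (e := ε / 4) (by positivity)
  have hev : ∀ᶠ m in atTop, ∀ y ∈ t, ‖R m y‖ < ε / 4 := by
    rw [eventually_all_finite htf]
    intro y _
    have := (h0 y).norm
    rw [norm_zero] at this
    exact this.eventually_lt_const (by positivity)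
  obtain ⟨N, hN⟩ := eventually_atTop.1 hev
  refine ⟨N, fun m hm => ?_⟩
  rw [dist_zero_right]
  refine lt_of_le_of_lt (ContinuousLinearMap.opNorm_le_of_unit_norm (C := ε / 2)
    (by positivity) fun x hx => ?_) (by linarith)
  have hxK : T x ∈ K := hTK ⟨x, by simp [hx], rfl⟩
  obtain ⟨y, hy, hxy⟩ := Set.mem_iUnion₂.1 (ht hxK)
  have h1 := hN m hm y hy
  rw [mem_ball, dist_eq_norm] at hxy
  have h2 : ‖R m (T x - y)‖ ≤ ‖T x - y‖ := (R m).le_of_opNorm_le (hR m) _ |>.trans (by simp)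
  have h3 : (R m ∘L T) x = R m (T x - y) + R m y := by simp
  rw [h3]
  refine (norm_add_le _ _).trans ?_
  linarith

variable [CompleteSpace H]

/-- Telescoping: passing from m to m + 1 adds S^m (1 - S S*) S*^m, which is compact. -/
theorem isCompactOperator_one_sub_pow_mul_adjoint_pow {S : H →L[ℂ] H}
    (hc : IsCompactOperator (1 - S * adjoint S : H →L[ℂ] H)) (m : ℕ) :
    IsCompactOperator (1 - S ^ m * adjoint S ^ m : H →L[ℂ] H) := by
  induction m with
  | zero => simpa using isCompactOperator_zero
  | succ m ih =>
    have h : (1 - S ^ (m + 1) * adjoint S ^ (m + 1) : H →L[ℂ] H)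
        = (1 - S ^ m * adjoint S ^ m) + S ^ m * ((1 - S * adjoint S) * adjoint S ^ m) := by
      rw [pow_succ, pow_succ']
      noncomm_ring
    rw [h]
    exact ih.add ((hc.comp_clm (adjoint S ^ m)).clm_comp (S ^ m))

/-- The asymptotic characterisation of compact operators by a contraction of class `C₀₀` whose
defect `1 - S S*` is compact. -/
theorem tfae_isCompactOperator_of_compact_defect {S : H →L[ℂ] H} (hS : ‖S‖ ≤ 1)
    (h0 : ∀ x, Tendsto (fun m : ℕ => (S ^ m) x) atTop (𝓝 0))
    (h0' : ∀ x, Tendsto (fun m : ℕ => (adjoint S ^ m) x) atTop (𝓝 0))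
    (hc : IsCompactOperator (1 - S * adjoint S : H →L[ℂ] H)) (T : H →L[ℂ] H) :
    List.TFAE [
      ∃ A : H →L[ℂ] H, Tendsto (fun m : ℕ => (adjoint S ^ m) ∘L T ∘L (S ^ m)) atTop (𝓝 A),
      Tendsto (fun m : ℕ => (adjoint S ^ m) ∘L T ∘L (S ^ m)) atTop (𝓝 0),
      IsCompactOperator T] := by
  have hS' : ‖adjoint S‖ ≤ 1 := by rwa [LinearIsometryEquiv.norm_map]
  have hSm := ContinuousLinearMap.norm_pow_le_one hS
  have hSm' := ContinuousLinearMap.norm_pow_le_one hS'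
  tfae_have 2 → 1 := fun h => ⟨0, h⟩
  tfae_have 1 → 2 := by
    rintro ⟨A, hA⟩
    have hfix : adjoint S * A * S = A := by
      have h1 : Tendsto (fun m : ℕ => adjoint S * ((adjoint S ^ m) ∘L T ∘L (S ^ m)) * S) atTop
          (𝓝 (adjoint S * A * S)) := (hA.const_mul _).mul_const _
      refine tendsto_nhds_unique (h1.congr fun m => ?_) (hA.comp (tendsto_add_atTop_nat 1))
      change adjoint S * (adjoint S ^ m * (T * S ^ m)) * S
        = adjoint S ^ (m + 1) * (T * S ^ (m + 1))
      rw [pow_succ', pow_succ]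
      noncomm_ring
    have hfix' : ∀ m : ℕ, adjoint S ^ m * A * S ^ m = A := by
      intro m
      induction m with
      | zero => simp
      | succ m ih =>
        calc adjoint S ^ (m + 1) * A * S ^ (m + 1)
            = adjoint S ^ m * (adjoint S * A * S) * S ^ m := by
              rw [pow_succ, pow_succ']; noncomm_ring
          _ = A := by rw [hfix, ih]
    have hA0 : A = 0 := by
      ext x
      have h2 : Tendsto (fun m : ℕ => A ((S ^ m) x)) atTop (𝓝 0) := by
        simpa [Function.comp_def] using (A.continuous.tendsto 0).comp (h0 x)
      have h3 := h2.norm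
      rw [norm_zero] at h3
      refine norm_le_zero_iff.1 (ge_of_tendsto' h3 fun m => ?_)
      calc ‖A x‖ = ‖(adjoint S ^ m) (A ((S ^ m) x))‖ :=
            congrArg norm (DFunLike.congr_fun (hfix' m) x).symm
        _ ≤ 1 * ‖A ((S ^ m) x)‖ := (adjoint S ^ m).le_of_opNorm_le (hSm' m) _
        _ = _ := one_mul _
    rwa [hA0] at hA
  tfae_have 3 → 2 := by
    intro hT
    have h1 := (hT.tendsto_comp_zero hSm' h0').norm
    rw [norm_zero] at h1
    refine squeeze_zero_norm (fun m => ?_) h1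
    calc ‖(adjoint S ^ m) ∘L T ∘L (S ^ m)‖ = ‖((adjoint S ^ m) ∘L T) ∘L (S ^ m)‖ := rfl
      _ ≤ ‖(adjoint S ^ m) ∘L T‖ * ‖S ^ m‖ := opNorm_comp_le _ _
      _ ≤ ‖(adjoint S ^ m) ∘L T‖ := mul_le_of_le_one_right (norm_nonneg _) (hSm m)
  tfae_have 2 → 3 := by
    intro h
    let B : ℕ → H →L[ℂ] H := fun m => S ^ m * ((adjoint S ^ m) ∘L T ∘L (S ^ m)) * adjoint S ^ m
    have hB : Tendsto B atTop (𝓝 0) := by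
      have h1 := h.norm
      rw [norm_zero] at h1
      refine squeeze_zero_norm (fun m => ?_) h1
      refine (norm_mul_le _ _).trans ((mul_le_of_le_one_right (norm_nonneg _) (hSm' m)).trans ?_)
      exact (norm_mul_le _ _).trans (mul_le_of_le_one_left (norm_nonneg _) (hSm m))
    have hlim : Tendsto (fun m => T - B m) atTop (𝓝 T) := by simpa using hB.const_sub T
    refine isCompactOperator_of_tendsto hlim (Eventually.of_forall fun m => ?_)
    have hm := isCompactOperator_one_sub_pow_mul_adjoint_pow hc m
    -- With Q = S^m S*^m, this is T - Q T Q = (1 - Q) T + Q T (1 - Q).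
    have e : T - B m = (1 - S ^ m * adjoint S ^ m) * T
        + (S ^ m * adjoint S ^ m * T) * (1 - S ^ m * adjoint S ^ m) := by
      change T - S ^ m * (adjoint S ^ m * (T * S ^ m)) * adjoint S ^ m = _
      noncomm_ring
    rw [e]
    exact (hm.comp_clm T).add (hm.clm_comp (S ^ m * adjoint S ^ m * T))
  tfae_finish

end CompactDefect

/-! ### Monomials, Taylor coefficients and the shift on the Hardy space. -/

namespace VectorHardy

variable {E : Type*} [NormedAddCommGroup E] [InnerProductSpace ℂ E] [CompleteSpace E]

namespace HardySpace

theorem norm_sq_eq_tsum (f : HardySpace E) : ‖f‖ ^ 2 = ∑' n, ‖taylorCoeff f n‖ ^ 2 := by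
  rw [← norm_coeffLp]
  simpa using lp.norm_rpow_eq_tsum (p := 2) (by simp) (coeffLp f)

theorem hasSum_norm_sq (f : HardySpace E) :
    HasSum (fun n => ‖taylorCoeff f n‖ ^ 2) (‖f‖ ^ 2) := by
  rw [norm_sq_eq_tsum]
  exact f.summable_coeff.hasSum

theorem ext_coeff {f g : HardySpace E} (h : ∀ n, taylorCoeff f n = taylorCoeff g n) : f = g :=
  coeffLp_injective (lp.ext (funext h))

theorem taylorCoeff_add (f g : HardySpace E) (n : ℕ) :
    taylorCoeff (f + g : HardySpace E) n = taylorCoeff f n + taylorCoeff g n :=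
  congrArg (fun a : lp (fun _ : ℕ => E) 2 => a n) (coeffLp_add f g)

variable (E) in
/-- The embedding `x ↦ z ^ n x` of `E` in `H²_E(𝔻)`. -/
noncomputable def monomial (n : ℕ) : E →ₗᵢ[ℂ] HardySpace E where
  toLinearMap := (coeffEquiv (E := E)).symm.toLinearEquiv.toLinearMap ∘ₗ
    (lp.singleContinuousLinearMap ℂ (fun _ : ℕ => E) 2 n).toLinearMap
  norm_map' x := by
    simp [-map_pow]

theorem coeffEquiv_monomial (n : ℕ) (x : E) :
    coeffEquiv (monomial E n x) = lp.single 2 n x :=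
  (coeffEquiv (E := E)).apply_symm_apply _

theorem taylorCoeff_monomial (n : ℕ) (x : E) (k : ℕ) :
    taylorCoeff (monomial E n x) k = if k = n then x else 0 := by
  have h := congrArg (fun a : lp (fun _ : ℕ => E) 2 => a k) (coeffEquiv_monomial n x)
  refine Eq.trans h ?_
  by_cases hk : k = n
  · subst hk; simp
  · simp [hk]

theorem monomial_apply (n : ℕ) (x : E) {z : ℂ} (hz : z ∈ ball (0 : ℂ) 1) :
    monomial E n x z = z ^ n • x := by
  refine ((monomial E n x).hasSum hz).unique ?_
  simp only [taylorCoeff_monomial, smul_ite, smul_zero]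
  convert hasSum_ite_eq n (z ^ n • x) using 2 with k
  split_ifs with h
  · rw [h]
  · rfl

/-- Pairing with monomials reads off coefficients; every adjoint below is computed this way. -/
theorem inner_monomial_left (n : ℕ) (x : E) (f : HardySpace E) :
    inner ℂ (monomial E n x) f = inner ℂ x (taylorCoeff f n) := by
  rw [inner_def, tsum_eq_single n]
  · simp [taylorCoeff_monomial]
  · intro k hk
    simp [taylorCoeff_monomial, hk]

theorem hasSum_monomial (f : HardySpace E) :
    HasSum (fun n => monomial E n (taylorCoeff f n)) f := by
  have h := (lp.hasSum_single (p := 2) (by simp) (coeffLp f)).mapL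
    ((coeffEquiv (E := E)).symm : lp (fun _ : ℕ => E) 2 →L[ℂ] HardySpace E)
  have h2 : (coeffEquiv (E := E)).symm (coeffLp f) = f := (coeffEquiv (E := E)).symm_apply_apply f
  have h' : HasSum (fun n => (coeffEquiv (E := E)).symm (lp.single 2 n (coeffLp f n)))
    ((coeffEquiv (E := E)).symm (coeffLp f)) := h
  rw [h2] at h'
  exact h'

/-- A closed subspace that contains all monomials is the whole space. -/
theorem mem_of_monomial_mem (f : HardySpace E) {K : Submodule ℂ (HardySpace E)}
    (hK : IsClosed (K : Set (HardySpace E))) (h : ∀ n x, monomial E n x ∈ K) : f ∈ K :=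
  hK.mem_of_tendsto f.hasSum_monomial
    (Eventually.of_forall fun _ => K.sum_mem fun n _ => h n _)

theorem shift_monomial (n : ℕ) (x : E) : shift E (monomial E n x) = monomial E (n + 1) x := by
  ext z hz
  rw [shift_apply _ hz, monomial_apply _ _ hz, monomial_apply _ _ hz, smul_smul, pow_succ']

theorem shift_pow_monomial (m n : ℕ) (x : E) :
    (shift E ^ m) (monomial E n x) = monomial E (n + m) x := by
  induction m with
  | zero => simp
  | succ m ih =>
    rw [pow_succ', mul_apply_eq_comp, ih, shift_monomial, add_assoc]

theorem taylorCoeff_shift_zero (f : HardySpace E) : taylorCoeff (shift E f) 0 = 0 := by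
  simp [taylorCoeff, shift_apply]

theorem taylorCoeff_adjoint_shift (f : HardySpace E) (n : ℕ) :
    taylorCoeff (ContinuousLinearMap.adjoint (shift E) f) n = taylorCoeff f (n + 1) := by
  refine ext_inner_left ℂ fun x => ?_
  rw [← inner_monomial_left, ContinuousLinearMap.adjoint_inner_right, shift_monomial,
    inner_monomial_left]

theorem taylorCoeff_adjoint_shift_pow (m : ℕ) (f : HardySpace E) (n : ℕ) :
    taylorCoeff ((ContinuousLinearMap.adjoint (shift E) ^ m) f) n = taylorCoeff f (n + m) := by
  induction m generalizing n with
  | zero => simp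
  | succ m ih =>
    rw [pow_succ', mul_apply_eq_comp, taylorCoeff_adjoint_shift, ih]
    congr 1
    ring

theorem taylorCoeff_shift_succ (f : HardySpace E) (n : ℕ) :
    taylorCoeff (shift E f) (n + 1) = taylorCoeff f n := by
  have h : ∀ z ∈ ball (0 : ℂ) 1, HasSum
      (fun k : ℕ => z ^ k • (Nat.casesOn k 0 (taylorCoeff f) : E)) (shift E f z) := by
    intro z hz
    rw [shift_apply f hz]
    rw [← hasSum_nat_add_iff' 1]
    simpa [pow_succ', mul_smul] using (f.hasSum hz).const_smul z
  exact congrFun (taylorCoeff_eq (shift E f).differentiableOn h) (n + 1)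

theorem taylorCoeff_shift_pow (m : ℕ) (f : HardySpace E) (n : ℕ) :
    taylorCoeff ((shift E ^ m) f) n = if m ≤ n then taylorCoeff f (n - m) else 0 := by
  induction m generalizing n with
  | zero => simp
  | succ m ih =>
    rw [pow_succ', mul_apply_eq_comp]
    cases n with
    | zero => simp [taylorCoeff_shift_zero]
    | succ n => rw [taylorCoeff_shift_succ, ih]; simp

theorem norm_shift (f : HardySpace E) : ‖shift E f‖ = ‖f‖ := by
  rw [← sq_eq_sq₀ (norm_nonneg _) (norm_nonneg _)]
  refine (hasSum_norm_sq (shift E f)).unique ?_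
  rw [← hasSum_nat_add_iff' 1]
  simpa [taylorCoeff_shift_succ, taylorCoeff_shift_zero] using hasSum_norm_sq f

/-- The squared norms are the tails of the convergent series of squared coefficients. -/
theorem tendsto_adjoint_shift_pow (f : HardySpace E) :
    Tendsto (fun m : ℕ => (ContinuousLinearMap.adjoint (shift E) ^ m) f) atTop (𝓝 0) := by
  have h := tendsto_sum_nat_add fun n => ‖taylorCoeff f n‖ ^ 2
  rw [tendsto_zero_iff_norm_tendsto_zero]
  have h2 : ∀ m : ℕ, ‖(ContinuousLinearMap.adjoint (shift E) ^ m) f‖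
      = √(∑' n, ‖taylorCoeff f (n + m)‖ ^ 2) := by
    intro m
    rw [← Real.sqrt_sq (norm_nonneg _), norm_sq_eq_tsum]
    simp only [taylorCoeff_adjoint_shift_pow]
  simp only [h2]
  simpa using h.sqrt

/-- Both sides keep exactly the constant term of a function. -/
theorem one_sub_shift_mul_adjoint :
    (1 - shift E * ContinuousLinearMap.adjoint (shift E) : HardySpace E →L[ℂ] HardySpace E)
      = (monomial E 0).toContinuousLinearMap ∘L
        ContinuousLinearMap.adjoint (monomial E 0).toContinuousLinearMap := by
  have h0 : ∀ f : HardySpace E,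
      ContinuousLinearMap.adjoint (monomial E 0).toContinuousLinearMap f = taylorCoeff f 0 := by
    intro f
    refine ext_inner_left ℂ fun x => ?_
    rw [ContinuousLinearMap.adjoint_inner_right]
    exact inner_monomial_left 0 x f
  ext1 f
  suffices f = monomial E 0 (taylorCoeff f 0)
      + shift E (ContinuousLinearMap.adjoint (shift E) f) by
    simpa [h0, sub_eq_iff_eq_add] using this
  refine ext_coeff fun n => ?_
  rw [taylorCoeff_add, taylorCoeff_monomial]
  cases n with
  | zero => simp [taylorCoeff_shift_zero]
  | succ n => simp [taylorCoeff_shift_succ, taylorCoeff_adjoint_shift]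

theorem isCompactOperator_one_sub_shift_mul_adjoint [FiniteDimensional ℂ E] :
    IsCompactOperator
      (1 - shift E * ContinuousLinearMap.adjoint (shift E) : HardySpace E →L[ℂ] HardySpace E) := by
  have := FiniteDimensional.proper ℂ E
  rw [one_sub_shift_mul_adjoint]
  have h := isCompactOperator_of_locallyCompactSpace_dom
    (ContinuousLinearMap.adjoint (monomial E 0).toContinuousLinearMap)
  exact h.clm_comp (monomial E 0).toContinuousLinearMap

end HardySpace

end VectorHardy

/-! ### The model operator as a compression of the shift. -/

namespace VectorHardy

variable {E : Type*} [NormedAddCommGroup E] [InnerProductSpace ℂ E] [CompleteSpace E]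

open ContinuousLinearMap HardySpace

section Model

variable (Θ : HInfty E)

theorem HInfty.mulOp_shift (f : HardySpace E) :
    Θ.mulOp (shift E f) = shift E (Θ.mulOp f) := by
  ext z hz
  rw [Θ.mulOp_apply _ hz, shift_apply _ hz, shift_apply _ hz, Θ.mulOp_apply _ hz, map_smul]

theorem HInfty.mulOp_shift_pow (m : ℕ) (f : HardySpace E) :
    Θ.mulOp ((shift E ^ m) f) = (shift E ^ m) (Θ.mulOp f) := by
  induction m with
  | zero => simp
  | succ m ih => simp only [pow_succ', mul_apply_eq_comp, mulOp_shift, ih]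

/-- The range of multiplication by Θ is shift-invariant, so its orthogonal complement is invariant
under the adjoint. -/
theorem adjoint_shift_mem_modelSpace {f : HardySpace E} (hf : f ∈ modelSpace Θ) :
    adjoint (shift E) f ∈ modelSpace Θ := by
  rw [modelSpace, Submodule.mem_orthogonal]
  rintro _ ⟨g, rfl⟩
  rw [adjoint_inner_right]
  exact (Submodule.mem_orthogonal _ _).1 hf _ ⟨shift E g, Θ.mulOp_shift g⟩

theorem coe_adjoint_modelOp (f : modelSpace Θ) :
    (adjoint (modelOp Θ) f : HardySpace E) = adjoint (shift E) f := by
  have h : adjoint (modelOp Θ) f = ⟨_, adjoint_shift_mem_modelSpace Θ f.2⟩ := by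
    refine ext_inner_left ℂ fun g => ?_
    rw [adjoint_inner_right, Submodule.coe_inner _ g, adjoint_inner_right]
    exact Submodule.inner_orthogonalProjectionOnto_eq_of_mem_right f (shift E g)
  rw [h]

theorem coe_adjoint_modelOp_pow (m : ℕ) (f : modelSpace Θ) :
    ((adjoint (modelOp Θ) ^ m) f : HardySpace E) = (adjoint (shift E) ^ m) f := by
  induction m with
  | zero => simp
  | succ m ih => rw [pow_succ', pow_succ', mul_apply_eq_comp, mul_apply_eq_comp,
      coe_adjoint_modelOp, ih]

/-- This is the dual form of S* being the restriction of the backward shift; it lets powers of S be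
computed on all of the Hardy space. -/
theorem modelOp_orthogonalProjectionOnto (f : HardySpace E) :
    modelOp Θ ((modelSpace Θ).orthogonalProjectionOnto f)
      = (modelSpace Θ).orthogonalProjectionOnto (shift E f) := by
  refine ext_inner_left ℂ fun g => ?_
  rw [← adjoint_inner_left, Submodule.coe_inner, Submodule.coe_inner, coe_adjoint_modelOp]
  have h := Submodule.inner_orthogonalProjectionOnto_eq_of_mem_left
    (⟨_, adjoint_shift_mem_modelSpace Θ g.2⟩ : modelSpace Θ) f
  rw [Submodule.coe_inner] at h
  rw [h, ← Submodule.coe_inner, Submodule.inner_orthogonalProjectionOnto_eq_of_mem_left,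
    adjoint_inner_left]

theorem modelOp_pow_orthogonalProjectionOnto (m : ℕ) (f : HardySpace E) :
    (modelOp Θ ^ m) ((modelSpace Θ).orthogonalProjectionOnto f)
      = (modelSpace Θ).orthogonalProjectionOnto ((shift E ^ m) f) := by
  induction m with
  | zero => simp
  | succ m ih => rw [pow_succ', pow_succ', mul_apply_eq_comp, mul_apply_eq_comp, ih,
      modelOp_orthogonalProjectionOnto]

theorem norm_modelOp_le : ‖modelOp Θ‖ ≤ 1 := by
  refine opNorm_le_bound _ zero_le_one fun f => ?_
  rw [one_mul]
  calc ‖modelOp Θ f‖ = ‖(modelSpace Θ).orthogonalProjectionOnto (shift E f)‖ := rfl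
    _ ≤ ‖shift E f‖ := Submodule.norm_orthogonalProjectionOnto_apply_le _ _
    _ = ‖(f : HardySpace E)‖ := norm_shift _

theorem isCompactOperator_one_sub_modelOp_mul_adjoint [FiniteDimensional ℂ E] :
    IsCompactOperator
      (1 - modelOp Θ * adjoint (modelOp Θ) : modelSpace Θ →L[ℂ] modelSpace Θ) := by
  have h : (1 - modelOp Θ * adjoint (modelOp Θ) : modelSpace Θ →L[ℂ] modelSpace Θ)
      = (modelSpace Θ).orthogonalProjectionOnto ∘L (1 - shift E * adjoint (shift E)) ∘L
        (modelSpace Θ).subtypeL := by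
    ext1 f
    have h1 : modelOp Θ (adjoint (modelOp Θ) f)
        = (modelSpace Θ).orthogonalProjectionOnto (shift E (adjoint (shift E) f)) := by
      rw [← coe_adjoint_modelOp]
      rfl
    simp [h1]
  have hc := (isCompactOperator_one_sub_shift_mul_adjoint (E := E)).comp_clm
    (modelSpace Θ).subtypeL
  rw [h]
  exact hc.clm_comp (modelSpace Θ).orthogonalProjectionOnto

theorem tendsto_adjoint_modelOp_pow (f : modelSpace Θ) :
    Tendsto (fun m : ℕ => (adjoint (modelOp Θ) ^ m) f) atTop (𝓝 0) := by
  rw [tendsto_subtype_rng]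
  simpa only [coe_adjoint_modelOp_pow, ZeroMemClass.coe_zero] using tendsto_adjoint_shift_pow (f : HardySpace E)

/-- The operators S^m P are contractions, so the vectors on which they tend to 0 form a closed
subspace. It contains z^n x because S^m P sends this to P(z^(n+m) x). -/
theorem tendsto_modelOp_pow_of_monomial
    (h : ∀ x : E, Tendsto (fun m : ℕ => (modelSpace Θ).orthogonalProjectionOnto (monomial E m x))
      atTop (𝓝 0)) (f : modelSpace Θ) :
    Tendsto (fun m : ℕ => (modelOp Θ ^ m) f) atTop (𝓝 0) := by
  have hS := norm_pow_le_one (norm_modelOp_le Θ)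
  let K : Submodule ℂ (HardySpace E) :=
    { carrier := {g | Tendsto (fun m : ℕ =>
        (modelOp Θ ^ m) ((modelSpace Θ).orthogonalProjectionOnto g)) atTop (𝓝 0)}
      zero_mem' := by simp
      add_mem' := fun {g h} hg hh => by
        simpa only [Set.mem_ofPred_eq, map_add, add_zero] using Tendsto.add hg hh
      smul_mem' := fun c g hg => by
        simpa only [Set.mem_ofPred_eq, map_smul, smul_zero] using Tendsto.const_smul hg c }
  have hK : IsClosed (K : Set (HardySpace E)) := by
    rw [← isSeqClosed_iff_isClosed]
    intro u g hu hug
    change Tendsto _ _ _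
    rw [Metric.tendsto_atTop]
    intro ε hε
    obtain ⟨N, hN⟩ := Metric.tendsto_atTop.1 hug (ε / 2) (by positivity)
    obtain ⟨M, hM⟩ := Metric.tendsto_atTop.1 (hu N) (ε / 2) (by positivity)
    refine ⟨M, fun m hm => ?_⟩
    have h1 := hM m hm
    have h2 := hN N le_rfl
    rw [dist_comm, dist_eq_norm] at h2
    rw [dist_zero_right] at h1 ⊢
    have h3 : ‖(modelOp Θ ^ m) ((modelSpace Θ).orthogonalProjectionOnto (g - u N))‖
        ≤ ‖g - u N‖ :=
      ((modelOp Θ ^ m).le_of_opNorm_le (hS m) _).trans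
        ((one_mul _).trans_le
          (Submodule.norm_orthogonalProjectionOnto_apply_le (modelSpace Θ) (g - u N)))
    rw [map_sub, map_sub] at h3
    have h4 := norm_le_norm_sub_add
      ((modelOp Θ ^ m) ((modelSpace Θ).orthogonalProjectionOnto g))
      ((modelOp Θ ^ m) ((modelSpace Θ).orthogonalProjectionOnto (u N)))
    linarith
  have hmem : (f : HardySpace E) ∈ K := by
    refine mem_of_monomial_mem _ hK fun n x => ?_
    change Tendsto _ _ _
    simp only [modelOp_pow_orthogonalProjectionOnto, shift_pow_monomial]
    exact (h x).comp (tendsto_atTop_mono (fun m => Nat.le_add_left m n) tendsto_id)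
  have h5 : Tendsto (fun m : ℕ => (modelOp Θ ^ m)
    ((modelSpace Θ).orthogonalProjectionOnto (f : HardySpace E))) atTop (𝓝 0) := hmem
  simpa only [Submodule.orthogonalProjectionOnto_mem_subspace_eq_self] using h5

end Model

/-! ### Inner multipliers are isometric on polynomials. -/

theorem meanSq_le_norm_sq (f : HardySpace E) (r : Set.Ico (0 : ℝ) 1) : meanSq f r ≤ ‖f‖ ^ 2 := by
  rw [norm_sq_eq_tsum]
  exact meanSq_le f.differentiableOn.continuousOn (fun _ => f.hasSum) f.summable_coeff r

/-- By Parseval the mean square is a series in r^(2n) with nonnegative coefficients. Monotonicity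
makes the supremum defining the norm a limit as r → 1. -/
theorem meanSq_mono (f : HardySpace E) : Monotone (meanSq f) := by
  intro r s hrs
  have h := fun r : Set.Ico (0 : ℝ) 1 => hasSum_circleAverage f.differentiableOn.continuousOn
    (fun _ => f.hasSum) r.2.1 r.2.2
  refine hasSum_le (fun n => ?_) (h r) (h s)
  have := r.2.1
  have : (r : ℝ) ≤ s := hrs
  gcongr

/-- The limit of the mean squares of `f` over the circles of radius `r → 1`, if it exists, is
`‖f‖²`. -/
theorem norm_sq_eq_of_tendsto (f : HardySpace E) {l : ℝ}
    (h : Tendsto (fun r => Real.circleAverage (fun z => ‖f z‖ ^ 2) 0 r) (𝓝[<] 1) (𝓝 l)) :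
    ‖f‖ ^ 2 = l := by
  have hI : ∀ᶠ r in 𝓝[<] (1 : ℝ), r ∈ Set.Ico (0 : ℝ) 1 := Ico_mem_nhdsLT zero_lt_one
  refine le_antisymm ?_ (le_of_tendsto h ?_)
  · have : Nonempty (Set.Ico (0 : ℝ) 1) := ⟨⟨0, by simp⟩⟩
    rw [norm_sq_eq_tsum, ← iSup_meanSq f.differentiableOn.continuousOn (fun _ => f.hasSum)
      f.summable_coeff]
    refine ciSup_le fun r => ge_of_tendsto h ?_
    filter_upwards [hI, Ioo_mem_nhdsLT r.2.2] with s hs hrs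
    have hmono : meanSq f r ≤ meanSq f ⟨s, hs⟩ := meanSq_mono f hrs.1.le
    exact hmono
  · filter_upwards [hI] with r hr using meanSq_le_norm_sq f ⟨r, hr⟩

theorem tendsto_circleMap_radius (t : ℝ) :
    Tendsto (fun r : ℝ => circleMap 0 r t) (𝓝[<] 1) (𝓝 (circleMap 0 1 t)) := by
  have : Continuous fun r : ℝ => circleMap 0 r t := by unfold circleMap; fun_prop
  exact this.continuousAt.tendsto.mono_left nhdsWithin_le_nhds

/-- Dominated convergence: Θ is bounded on the disc and q on its closure, and the radial limits of Θ
preserve norms. -/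
theorem HInfty.IsInner.tendsto_circleAverage {Θ : HInfty E} (hΘ : Θ.IsInner) {q : ℂ → E}
    (hq : Continuous q) :
    Tendsto (fun r => Real.circleAverage (fun z => ‖Θ z (q z)‖ ^ 2) 0 r) (𝓝[<] 1)
      (𝓝 (Real.circleAverage (fun z => ‖q z‖ ^ 2) 0 1)) := by
  obtain ⟨C, hC⟩ := Θ.bounded'
  have hC0 : 0 ≤ C := (norm_nonneg _).trans (hC 0 (by simp))
  obtain ⟨B, hB⟩ := (isCompact_closedBall (0 : ℂ) 1).exists_bound_of_continuousOn hq.continuousOn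
  have hI : ∀ᶠ r in 𝓝[<] (1 : ℝ), r ∈ Set.Ico (0 : ℝ) 1 := Ico_mem_nhdsLT zero_lt_one
  simp only [Real.circleAverage_def]
  refine Tendsto.const_smul ?_ _
  refine intervalIntegral.tendsto_integral_filter_of_dominated_convergence
    (fun _ => (C * B) ^ 2) ?_ ?_ intervalIntegrable_const ?_
  · filter_upwards [hI] with r hr
    have h1 : Continuous fun t : ℝ => Θ (circleMap 0 r t) :=
      Θ.differentiableOn'.continuousOn.comp_continuous (continuous_circleMap 0 r)
        (circleMap_mem_unit hr.1 hr.2)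
    exact ((h1.clm_apply (hq.comp (continuous_circleMap 0 r))).norm.pow 2).aestronglyMeasurable
  · filter_upwards [hI] with r hr
    refine Eventually.of_forall fun t _ => ?_
    have hz := circleMap_mem_unit hr.1 hr.2 t
    rw [norm_pow, norm_norm]
    gcongr
    exact (Θ _).le_of_opNorm_le_of_le (hC _ hz) (hB _ (ball_subset_closedBall hz))
  · filter_upwards [hΘ] with t ht _
    obtain ⟨V, hV, hlim⟩ := ht
    -- The strong radial limit applies to a fixed vector only, so q is first frozen at the boundary
    -- point; the bound C on Θ controls the error.
    have h1 : Tendsto (fun r : ℝ => Θ (circleMap 0 r t)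
        (q (circleMap 0 r t) - q (circleMap 0 1 t))) (𝓝[<] 1) (𝓝 0) := by
      have h2 : Tendsto (fun r : ℝ => C * ‖q (circleMap 0 r t) - q (circleMap 0 1 t)‖) (𝓝[<] 1)
          (𝓝 0) := by
        have := (((hq.tendsto _).comp (tendsto_circleMap_radius t)).sub_const
          (q (circleMap 0 1 t))).norm.const_mul C
        simpa using this
      refine squeeze_zero_norm' ?_ h2
      filter_upwards [hI] with r hr
      exact (Θ _).le_of_opNorm_le (hC _ (circleMap_mem_unit hr.1 hr.2 t)) _
    have h3 := (h1.add (hlim (q (circleMap 0 1 t)))).norm.pow 2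
    simpa [hV] using h3

theorem HInfty.IsInner.norm_sq_eq_circleAverage {Θ : HInfty E} (hΘ : Θ.IsInner)
    {f : HardySpace E} {q : ℂ → E} (hq : Continuous q)
    (hf : ∀ z ∈ ball (0 : ℂ) 1, f z = Θ z (q z)) :
    ‖f‖ ^ 2 = Real.circleAverage (fun z => ‖q z‖ ^ 2) 0 1 := by
  refine norm_sq_eq_of_tendsto f ((hΘ.tendsto_circleAverage hq).congr' ?_)
  filter_upwards [Ico_mem_nhdsLT (zero_lt_one' ℝ)] with r hr
  refine Real.circleAverage_congr_sphere fun z hz => ?_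
  rw [abs_of_nonneg hr.1] at hz
  simp only [hf z (sphere_subset_ball hr.2 hz)]

/-- Multiplication by an inner function preserves the norm of functions that are continuous up to
the boundary. -/
theorem HInfty.IsInner.norm_mulOp_of_continuous {Θ : HInfty E} (hΘ : Θ.IsInner) {f : HardySpace E}
    {q : ℂ → E} (hq : Continuous q) (hf : ∀ z ∈ ball (0 : ℂ) 1, f z = q z) :
    ‖Θ.mulOp f‖ = ‖f‖ := by
  -- The constant function I is itself inner, so one formula gives the norms of both f and Θ f as
  -- the same boundary integral.
  let I : HInfty E := ⟨fun _ => ContinuousLinearMap.id ℂ E, differentiableOn_const _,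
    1, fun _ _ => norm_id_le⟩
  have hI : I.IsInner := Eventually.of_forall fun t =>
    ⟨ContinuousLinearMap.id ℂ E, fun _ => rfl, fun _ => tendsto_const_nhds⟩
  rw [← sq_eq_sq₀ (norm_nonneg _) (norm_nonneg _), hI.norm_sq_eq_circleAverage hq hf,
    hΘ.norm_sq_eq_circleAverage hq fun z hz => by rw [Θ.mulOp_apply f hz, hf z hz]]

theorem HInfty.IsInner.norm_mulOp_sum_monomial {Θ : HInfty E} (hΘ : Θ.IsInner) (s : Finset ℕ)
    (a : ℕ → E) :
    ‖Θ.mulOp (∑ n ∈ s, monomial E n (a n))‖ = ‖∑ n ∈ s, monomial E n (a n)‖ := by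
  have hq : Continuous fun z : ℂ => ∑ n ∈ s, z ^ n • a n := by fun_prop
  refine hΘ.norm_mulOp_of_continuous hq fun z hz => ?_
  induction s using Finset.cons_induction with
  | empty => simp; rfl
  | cons n s hn ih =>
    rw [Finset.sum_cons, Finset.sum_cons, HardySpace.add_apply, ih (by fun_prop), monomial_apply n _ hz]

/-! ### The adjoint multiplier on monomials and the trace argument. -/

variable {Θ : HInfty E}

/-- Move the adjoint across and commute Θ with the shift: ⟨z^k y, Θ*(z^m x)⟩ = ⟨z^k Θ y, z^m x⟩,
which sees the coefficient of index m - k of Θ y. -/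
theorem inner_taylorCoeff_adjoint_mulOp_monomial (x y : E) (m k : ℕ) :
    inner ℂ y (taylorCoeff (adjoint Θ.mulOp (monomial E m x)) k)
      = if k ≤ m then inner ℂ (taylorCoeff (Θ.mulOp (monomial E 0 y)) (m - k)) x else 0 := by
  rw [← inner_monomial_left, adjoint_inner_right, ← inner_conj_symm, inner_monomial_left,
    inner_conj_symm, ← zero_add k, ← shift_pow_monomial, Θ.mulOp_shift_pow, taylorCoeff_shift_pow,
    zero_add]
  split_ifs <;> simp

theorem taylorCoeff_adjoint_mulOp_monomial_of_lt (x : E) {m k : ℕ} (h : m < k) :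
    taylorCoeff (adjoint Θ.mulOp (monomial E m x)) k = 0 := by
  refine ext_inner_left ℂ fun y => ?_
  rw [inner_taylorCoeff_adjoint_mulOp_monomial, if_neg (not_le.2 h), inner_zero_right]

/-- Θ*(z^m x) is a polynomial of degree at most m, so the isometry on polynomials is enough. -/
theorem HInfty.IsInner.norm_mulOp_adjoint_monomial (hΘ : Θ.IsInner) (m : ℕ) (x : E) :
    ‖Θ.mulOp (adjoint Θ.mulOp (monomial E m x))‖ = ‖adjoint Θ.mulOp (monomial E m x)‖ := by
  have h := (hasSum_monomial (adjoint Θ.mulOp (monomial E m x))).unique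
    (hasSum_sum_of_ne_finset_zero (s := Finset.range (m + 1)) fun k hk => by
      rw [taylorCoeff_adjoint_mulOp_monomial_of_lt x (by simpa using hk), map_zero])
  rw [h]
  exact hΘ.norm_mulOp_sum_monomial _ _

/-- The distance from `z ^ m x` to the range of an inner multiplier. -/
theorem HInfty.IsInner.norm_sq_projection_monomial_le (hΘ : Θ.IsInner) (m : ℕ) (x : E) :
    ‖(modelSpace Θ).orthogonalProjectionOnto (monomial E m x)‖ ^ 2
      ≤ ‖x‖ ^ 2 - ‖adjoint Θ.mulOp (monomial E m x)‖ ^ 2 := by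
  set g := adjoint Θ.mulOp (monomial E m x) with hg
  have h0 : (modelSpace Θ).orthogonalProjectionOnto (Θ.mulOp g) = 0 := by
    rw [Submodule.orthogonalProjectionOnto_eq_zero_iff]
    exact Submodule.le_orthogonal_orthogonal _ ⟨g, rfl⟩
  have h1 : (modelSpace Θ).orthogonalProjectionOnto (monomial E m x)
      = (modelSpace Θ).orthogonalProjectionOnto (monomial E m x - Θ.mulOp g) := by
    rw [map_sub, h0, sub_zero]
  have h2 : ‖monomial E m x - Θ.mulOp g‖ ^ 2 = ‖x‖ ^ 2 - ‖g‖ ^ 2 := by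
    -- The cross term is ⟨z^m x, Θ g⟩ = ⟨g, g⟩, so the square expands to ‖x‖² - 2‖g‖² + ‖g‖².
    rw [@norm_sub_sq ℂ, hΘ.norm_mulOp_adjoint_monomial, ← adjoint_inner_left, ← hg,
      inner_self_eq_norm_sq, LinearIsometry.norm_map]
    ring
  rw [h1, ← h2]
  gcongr
  exact Submodule.norm_orthogonalProjectionOnto_apply_le _ _

theorem norm_sq_adjoint_mulOp_monomial {ι : Type*} [Fintype ι] (b : OrthonormalBasis ι ℂ E)
    (m : ℕ) (x : E) :
    ‖adjoint Θ.mulOp (monomial E m x)‖ ^ 2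
      = ∑ n ∈ Finset.range (m + 1), ∑ j,
        ‖inner ℂ (taylorCoeff (Θ.mulOp (monomial E 0 (b j))) n) x‖ ^ 2 := by
  -- Coefficients of index above m vanish; reflecting k to m - k then matches the coefficients of Θ
  -- b_j in increasing order.
  rw [norm_sq_eq_tsum, tsum_eq_sum (s := Finset.range (m + 1)) fun k hk => by
    rw [taylorCoeff_adjoint_mulOp_monomial_of_lt x (by simpa using hk)]; simp,
    ← Finset.sum_range_reflect]
  refine Finset.sum_congr rfl fun k hk => ?_
  have hkm : k ≤ m := Nat.lt_succ_iff.1 (Finset.mem_range.1 hk)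
  rw [← b.sum_sq_norm_inner_right]
  refine Finset.sum_congr rfl fun j _ => ?_
  rw [inner_taylorCoeff_adjoint_mulOp_monomial, if_pos (by omega)]
  congr 5
  omega

/-- A trace computation: exchanging the two basis sums and applying Parseval in i leaves the partial
sums of ∑_j ‖Θ b_j‖², and each ‖Θ b_j‖ is 1. -/
theorem HInfty.IsInner.tendsto_norm_sq_adjoint {ι : Type*} [Fintype ι] (hΘ : Θ.IsInner)
    (b : OrthonormalBasis ι ℂ E) :
    Tendsto (fun m : ℕ => ∑ i, ‖adjoint Θ.mulOp (monomial E m (b i))‖ ^ 2) atTop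
      (𝓝 (Fintype.card ι)) := by
  have h1 : ∀ m : ℕ, ∑ i, ‖adjoint Θ.mulOp (monomial E m (b i))‖ ^ 2
      = ∑ j, ∑ n ∈ Finset.range (m + 1), ‖taylorCoeff (Θ.mulOp (monomial E 0 (b j))) n‖ ^ 2 := by
    intro m
    simp only [norm_sq_adjoint_mulOp_monomial b]
    rw [Finset.sum_comm]
    conv_rhs => rw [Finset.sum_comm]
    refine Finset.sum_congr rfl fun n _ => ?_
    rw [Finset.sum_comm]
    exact Finset.sum_congr rfl fun j _ => b.sum_sq_norm_inner_left _
  have h2 : ∀ j, ‖Θ.mulOp (monomial E 0 (b j))‖ ^ 2 = 1 := by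
    intro j
    have := hΘ.norm_mulOp_sum_monomial {0} fun _ => b j
    simp only [Finset.sum_singleton] at this
    rw [this, LinearIsometry.norm_map, b.norm_eq_one, one_pow]
  have h3 : Tendsto (fun m : ℕ => ∑ j, ∑ n ∈ Finset.range (m + 1),
      ‖taylorCoeff (Θ.mulOp (monomial E 0 (b j))) n‖ ^ 2) atTop (𝓝 (∑ _j : ι, 1)) := by
    refine tendsto_finsetSum _ fun j _ => ?_
    rw [← h2 j]
    exact (hasSum_norm_sq _).tendsto_sum_nat.comp (tendsto_add_atTop_nat 1)
  simpa [h1] using h3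

theorem HInfty.IsInner.tendsto_projection_monomial [FiniteDimensional ℂ E] (hΘ : Θ.IsInner)
    (x : E) :
    Tendsto (fun m : ℕ => (modelSpace Θ).orthogonalProjectionOnto (monomial E m x)) atTop
      (𝓝 0) := by
  let b := stdOrthonormalBasis ℂ E
  have hb : ∀ i, Tendsto
      (fun m : ℕ => (modelSpace Θ).orthogonalProjectionOnto (monomial E m (b i))) atTop (𝓝 0) := by
    intro i
    have h1 : Tendsto (fun m : ℕ => ∑ j, (1 - ‖adjoint Θ.mulOp (monomial E m (b j))‖ ^ 2)) atTop
        (𝓝 0) := by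
      simpa using (hΘ.tendsto_norm_sq_adjoint b).const_sub (Module.finrank ℂ E : ℝ)
    have hle : ∀ (m : ℕ) j, ‖(modelSpace Θ).orthogonalProjectionOnto (monomial E m (b j))‖ ^ 2
        ≤ 1 - ‖adjoint Θ.mulOp (monomial E m (b j))‖ ^ 2 := by
      intro m j
      simpa [b.norm_eq_one] using hΘ.norm_sq_projection_monomial_le m (b j)
    have h2 : Tendsto
        (fun m : ℕ => ‖(modelSpace Θ).orthogonalProjectionOnto (monomial E m (b i))‖ ^ 2) atTop
        (𝓝 0) := by
      refine squeeze_zero (fun m => by positivity) (fun m => (hle m i).trans ?_) h1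
      -- Each defect dominates a square and so is nonnegative; hence a single one is at most their
      -- sum, which tends to 0.
      exact Finset.single_le_sum (fun j _ => (by positivity : (0 : ℝ) ≤ _).trans (hle m j))
        (Finset.mem_univ i)
    rw [tendsto_zero_iff_norm_tendsto_zero]
    simpa using h2.sqrt
  have h3 : ∀ m : ℕ, (modelSpace Θ).orthogonalProjectionOnto (monomial E m x)
      = ∑ i, inner ℂ (b i) x • (modelSpace Θ).orthogonalProjectionOnto (monomial E m (b i)) := by
    intro m
    conv_lhs => rw [← b.sum_repr' x]
    simp only [map_sum, map_smul]
  simp only [h3]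
  simpa using tendsto_finsetSum Finset.univ fun i _ => (hb i).const_smul (inner ℂ (b i) x)

end VectorHardy

/-! ### The characterisation for the model operator. -/

theorem theorem5p6 (p : ℕ) (Θ : VectorHardy.HInfty (EuclideanSpace ℂ (Fin p))) (hΘ : Θ.IsInner)
    (T : VectorHardy.modelSpace Θ →L[ℂ] VectorHardy.modelSpace Θ) :
    List.TFAE [
      ∃ A : VectorHardy.modelSpace Θ →L[ℂ] VectorHardy.modelSpace Θ,
        Tendsto (fun m : ℕ => (ContinuousLinearMap.adjoint (VectorHardy.modelOp Θ) ^ m) ∘L T ∘L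
          (VectorHardy.modelOp Θ ^ m)) atTop (𝓝 A),
      Tendsto (fun m : ℕ => (ContinuousLinearMap.adjoint (VectorHardy.modelOp Θ) ^ m) ∘L T ∘L
          (VectorHardy.modelOp Θ ^ m)) atTop (𝓝 0),
      IsCompactOperator T] :=
  tfae_isCompactOperator_of_compact_defect (VectorHardy.norm_modelOp_le Θ)
    (VectorHardy.tendsto_modelOp_pow_of_monomial Θ hΘ.tendsto_projection_monomial)
    (VectorHardy.tendsto_adjoint_modelOp_pow Θ)
    (VectorHardy.isCompactOperator_one_sub_modelOp_mul_adjoint Θ) T
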